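/- Let $X$ be a closed (compact, connected) Riemann surface, $L$ a holomorphic line bundle over $X$, $\alpha\in\mathbb R$, and let $(V,\varphi)$ be an $L$-twisted $\operatorname{Sp}(2n,\mathbb R)$-Higgs pair: $V$ is a holomorphic vector bundle over $X$ of rank $n$ and $\varphi=(\beta,\gamma)\in H^0(L\otimes S^2V\oplus L\otimes S^2V^*)$. For subbundles $W',W''$ of a vector bundle $W$, let $W'\otimes_S W''\subset S^2W$ be the image of $W'\otimes W''$ in the symmetric square $S^2W$, and for a subbundle $W\subset V$ let $W^\perp\subset V^*$ be the kernel of the restriction map $V^*\to W^*$. For a filtration $\mathcal V=(0=V_0\subsetneq V_1\subsetneq\dots\subsetneq V_k=V)$ by holomorphic subbundles, with $k\ge 1$ and $n_j=\operatorname{rk}V_j$, and real numbers $\lambda=(\lambda_1\le\dots\le\lambda_k)$, put $$N(\mathcal V,\lambda)=\sum_{\lambda_i+\lambda_j\le 0}L\otimes V_i\otimes_S V_j\ \oplus\sum_{\lambda_i+\lambda_j\ge 0}L\otimes V_{i-1}^\perp\otimes_S V_{j-1}^\perp\ \subset\ L\otimes(S^2V\oplus S^2V^*),$$ $$d(\mathcal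 V,\lambda,\alpha)=\lambda_k(\deg V_k-\alpha n_k)+\sum_{j=1}^{k-1}(\lambda_j-\lambda_{j+1})(\deg V_j-\alpha n_j).$$ The pair $(V,\varphi)$ is called $\alpha$-semistable if $d(\mathcal V,\lambda,\alpha)\ge 0$ for every such $\mathcal V$ and $\lambda$ with $\varphi\in H^0(N(\mathcal V,\lambda))$. **Theorem.** The pair $(V,\varphi)$ is $\alpha$-semistable if and only if, for every filtration by holomorphic subbundles $0\subset V_1\subset V_2\subset V$ (inclusions not necessarily strict) such that $$\varphi\in H^0\bigl(L\otimes\bigl((S^2V_2+V_1\otimes_S V)\oplus(S^2V_1^\perp+V_2^\perp\otimes_S V^*)\bigr)\bigr),$$ one has $$\deg V-\deg V_2-\deg V_1\ \ge\ \alpha\,(n-n_2-n_1),\qquad n_i=\operatorname{rk}V_i.$$ -/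

import Mathlib

open scoped Manifold ContDiff Bundle TensorProduct
open Bundle

noncomputable section

namespace SpHiggs

universe u v w

/-! ### Linear algebra in one fibre -/

section Fibre

variable {M : Type u} [AddCommGroup M] [Module ℂ M]

/-- The product `a · b` in the symmetric square `S²M`. -/
def symMul (a b : M) : Sym[ℂ]^2 M := SymmetricPower.tprod ℂ ![a, b]

/-- `W' ⊗_S W'' ⊆ S²M`: the image of `W' ⊗ W'' ⊆ M ⊗ M` in the symmetric square `S²M`. -/
def symProd (W' W'' : Submodule ℂ M) : Submodule ℂ (Sym[ℂ]^2 M) :=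
  Submodule.span ℂ (Set.image2 symMul (W' : Set M) (W'' : Set M))

/-- `S²W`, as a subspace of `S²M`. -/
def symSq (W : Submodule ℂ M) : Submodule ℂ (Sym[ℂ]^2 M) := symProd W W

/-- `ℓ ⊗ N ⊆ ℓ ⊗ A` for a subspace `N ⊆ A`. -/
def twist (l : Type v) [AddCommMonoid l] [Module ℂ l] {A : Type w} [AddCommMonoid A] [Module ℂ A]
    (N : Submodule ℂ A) : Submodule ℂ (l ⊗[ℂ] A) :=
  LinearMap.range (N.subtype.lTensor l)

end Fibre

/-! ### Holomorphic sections -/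

section Sections

variable {X : Type u} [TopologicalSpace X] [ChartedSpace ℂ X]

/-- The section `s` of the vector bundle `E` (with model fibre `F`) over the Riemann surface `X`
is holomorphic on `U`. -/
def IsHolOn (F : Type v) [NormedAddCommGroup F] [NormedSpace ℂ F] {E : X → Type w}
    [TopologicalSpace (TotalSpace F E)] [∀ x, TopologicalSpace (E x)] [FiberBundle F E]
    (s : ∀ x, E x) (U : Set X) : Prop :=
  ContMDiffOn 𝓘(ℂ) (𝓘(ℂ).prod 𝓘(ℂ, F)) ω (fun x => TotalSpace.mk' F x (s x)) U

/-- `s` is a global holomorphic section of `L ⊗ S²E`, where `L` is a line bundle: locally on `X`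
it is a finite sum of terms `l ⊗ (v · w)` with `l` a holomorphic section of `L` and `v`, `w`
holomorphic sections of `E`. -/
def IsHolTwistedSymSection {L : X → Type v}
    [TopologicalSpace (TotalSpace ℂ L)] [∀ x, TopologicalSpace (L x)] [FiberBundle ℂ L]
    [∀ x, AddCommGroup (L x)] [∀ x, Module ℂ (L x)]
    (F : Type*) [NormedAddCommGroup F] [NormedSpace ℂ F] {E : X → Type w}
    [TopologicalSpace (TotalSpace F E)] [∀ x, TopologicalSpace (E x)] [FiberBundle F E]
    [∀ x, AddCommGroup (E x)] [∀ x, Module ℂ (E x)]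
    (s : ∀ x, L x ⊗[ℂ] Sym[ℂ]^2 (E x)) : Prop :=
  ∀ x₀ : X, ∃ U : Set X, IsOpen U ∧ x₀ ∈ U ∧
    ∃ (m : ℕ) (l : Fin m → ∀ x, L x) (v w : Fin m → ∀ x, E x),
      (∀ i, IsHolOn ℂ (l i) U) ∧ (∀ i, IsHolOn F (v i) U) ∧ (∀ i, IsHolOn F (w i) U) ∧
      ∀ x ∈ U, s x = ∑ i, l i x ⊗ₜ[ℂ] symMul (v i x) (w i x)

end Sections

/-! ### Subbundles, rank, degree -/

section Subbundles

variable {X : Type u} [TopologicalSpace X] [ChartedSpace ℂ X]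
  (F : Type v) [NormedAddCommGroup F] [NormedSpace ℂ F] {V : X → Type w}
  [TopologicalSpace (TotalSpace F V)] [∀ x, TopologicalSpace (V x)] [FiberBundle F V]
  [∀ x, AddCommGroup (V x)] [∀ x, Module ℂ (V x)]

/-- `e` is a holomorphic frame over `U` of the family of subspaces `W x ⊆ V x`. -/
structure IsHolFrameOn (W : ∀ x, Submodule ℂ (V x)) {r : ℕ} (e : Fin r → ∀ x, V x)
    (U : Set X) : Prop where
  hol : ∀ i, IsHolOn F (e i) U
  linearIndependent : ∀ x ∈ U, LinearIndependent ℂ (fun i => e i x)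
  span_eq : ∀ x ∈ U, Submodule.span ℂ (Set.range fun i => e i x) = W x

variable (V) in
/-- A holomorphic subbundle of `V`: a family of subspaces of the fibres that has, locally on `X`,
holomorphic frames with `rank` members. -/
structure HolSubbundle where
  fiber : ∀ x, Submodule ℂ (V x)
  rank : ℕ
  exists_frame : ∀ x₀ : X, ∃ U : Set X, IsOpen U ∧ x₀ ∈ U ∧
    ∃ e : Fin rank → ∀ x, V x, IsHolFrameOn F fiber e U

namespace HolSubbundle

variable {F}

/-- Subbundles are ordered by inclusion, fibre by fibre. -/
instance : Preorder (HolSubbundle F V) := Preorder.lift HolSubbundle.fiber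

/-- The zero subbundle. -/
instance : Bot (HolSubbundle F V) where
  bot :=
    { fiber := fun _ => ⊥
      rank := 0
      exists_frame := fun _ => ⟨Set.univ, isOpen_univ, trivial, fun i => i.elim0,
        ⟨fun i => i.elim0, fun _ _ => linearIndependent_empty_type, fun _ _ => by simp⟩⟩ }

/-- The whole bundle `V`, as a subbundle of itself. -/
instance [FiniteDimensional ℂ F] [VectorBundle ℂ F V] [ContMDiffVectorBundle ω F V 𝓘(ℂ)] :
    Top (HolSubbundle F V) where
  top :=
    { fiber := fun _ => ⊤
      rank := Module.finrank ℂ F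
      exists_frame := fun x₀ => by
        have h := (trivializationAt F V x₀).isLocalFrameOn_localFrame_baseSet 𝓘(ℂ) ω
          (Module.finBasis ℂ F)
        exact ⟨(trivializationAt F V x₀).baseSet, (trivializationAt F V x₀).open_baseSet,
          FiberBundle.mem_baseSet_trivializationAt F V x₀, _,
          ⟨h.contMDiffOn, fun _ hx => h.linearIndependent hx,
            fun _ hx => top_le_iff.mp (h.generating hx)⟩⟩ }

/-- `s₁, …, s_r`, with `r = rk W`, are sections of `W` near `x₀`, except perhaps at `x₀` itself,
that are meromorphic at `x₀`, and the section `s₁ ∧ ⋯ ∧ s_r` of `det W = Λʳ W` has order `m` at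
`x₀`. Here `A` is the matrix of coefficients of the `s_j` in a holomorphic frame `e` of `W` around
`x₀`, so that `s₁ ∧ ⋯ ∧ s_r = det A · e₁ ∧ ⋯ ∧ e_r`, and the order is read in the chart at `x₀`. -/
def HasWedgeOrderAt (W : HolSubbundle F V) (s : Fin W.rank → ∀ x, V x) (x₀ : X) (m : ℤ) : Prop :=
  ∃ (U : Set X) (e : Fin W.rank → ∀ x, V x) (A : X → Matrix (Fin W.rank) (Fin W.rank) ℂ),
    IsOpen U ∧ x₀ ∈ U ∧ IsHolFrameOn F W.fiber e U ∧
    (∀ x ∈ U, x ≠ x₀ → ∀ j, s j x = ∑ i, A x i j • e i x) ∧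
    (∀ i j, MeromorphicAt (fun z => A ((chartAt ℂ x₀).symm z) i j) (chartAt ℂ x₀ x₀)) ∧
    meromorphicOrderAt (fun z => (A ((chartAt ℂ x₀).symm z)).det) (chartAt ℂ x₀ x₀) = m

/-- `d` is the degree of the divisor `D` (zeros minus poles) of a non-zero meromorphic section of
`det W` of the form `s₁ ∧ ⋯ ∧ s_r`, where `s₁, …, s_r` are meromorphic sections of `W` over `X`. -/
def HasDegree (W : HolSubbundle F V) (d : ℤ) : Prop :=
  ∃ (s : Fin W.rank → ∀ x, V x) (D : X →₀ ℤ),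
    (∀ x, W.HasWedgeOrderAt s x (D x)) ∧ d = D.sum fun _ m => m

open scoped Classical in
/-- The degree of `W`, that is, the degree of the divisor of a meromorphic section of `det W`.
On a closed Riemann surface there is exactly one `d` with `W.HasDegree d`: every holomorphic vector
bundle has a meromorphic frame, and principal divisors have degree `0`. -/
def degree (W : HolSubbundle F V) : ℤ :=
  if h : ∃ d, W.HasDegree d then h.choose else 0

end HolSubbundle

end Subbundles

/-! ### Higgs pairs and semistability -/

section Pairs

variable {X : Type u} [TopologicalSpace X] [ChartedSpace ℂ X]
  (L : X → Type v) [TopologicalSpace (TotalSpace ℂ L)] [∀ x, TopologicalSpace (L x)]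
  [FiberBundle ℂ L] [∀ x, AddCommGroup (L x)] [∀ x, Module ℂ (L x)]
  (F : Type*) [NormedAddCommGroup F] [NormedSpace ℂ F] (V : X → Type w)
  [TopologicalSpace (TotalSpace F V)] [∀ x, TopologicalSpace (V x)] [FiberBundle F V]
  [∀ x, AddCommGroup (V x)] [∀ x, Module ℂ (V x)]

/-- The fibre at `x` of the dual bundle `V*`. -/
abbrev Dual (x : X) : Type w := V x →L[ℂ] Bundle.Trivial X ℂ x

variable {V} in
/-- `W^⊥ ⊆ V*`, the kernel of the restriction map `V* → W*`, in the fibre at `x`. -/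
def perp {x : X} (W : Submodule ℂ (V x)) : Submodule ℂ (Dual V x) where
  carrier := {f | ∀ y ∈ W, f y = 0}
  add_mem' := fun {f g} hf hg y hy => by
    rw [add_apply, hf y hy, hg y hy, add_zero]
  zero_mem' := fun _ _ => rfl
  smul_mem' := fun c f hf y hy => by
    rw [smul_apply, hf y hy, smul_zero]

variable [VectorBundle ℂ F V]

/-- The Higgs field `φ = (β, γ) ∈ H⁰(L ⊗ S²V ⊕ L ⊗ S²V*)` of an `L`-twisted
`Sp(2n,ℝ)`-Higgs pair with underlying bundle `V`. -/
structure HiggsField where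
  beta : ∀ x, L x ⊗[ℂ] Sym[ℂ]^2 (V x)
  gamma : ∀ x, L x ⊗[ℂ] Sym[ℂ]^2 (Dual V x)
  beta_hol : IsHolTwistedSymSection F beta
  gamma_hol : IsHolTwistedSymSection (F →L[ℂ] ℂ) gamma

variable {L F V}

/-- `φ = (β, γ)` is a section of `L ⊗ (B ⊕ C)`, where `B` and `C` are given by their fibres
`B x ⊆ S²V_x` and `C x ⊆ S²V_x*`. -/
def HiggsField.MemSub (φ : HiggsField L F V) (B : ∀ x, Submodule ℂ (Sym[ℂ]^2 (V x)))
    (C : ∀ x, Submodule ℂ (Sym[ℂ]^2 (Dual V x))) : Prop :=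
  ∀ x, φ.beta x ∈ twist (L x) (B x) ∧ φ.gamma x ∈ twist (L x) (C x)

variable [FiniteDimensional ℂ F] [ContMDiffVectorBundle ω F V 𝓘(ℂ)]

variable (F V) in
/-- A filtration `0 = V₀ ⊊ V₁ ⊊ ⋯ ⊊ V_k = V` by holomorphic subbundles, with `k = m + 1`. -/
structure Filtration (m : ℕ) where
  sub : Fin (m + 2) → HolSubbundle F V
  strictMono : StrictMono sub
  sub_zero : sub 0 = ⊥
  sub_last : sub (Fin.last (m + 1)) = ⊤

namespace Filtration

variable {m : ℕ}

/-- The `S²V`-part of `N(𝒱, λ)` (before the twist by `L`): the sum of the `V_i ⊗_S V_j` over all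
`i, j` with `λ_i + λ_j ≤ 0`. The weight attached to `V_{i+1}` is `l i`, for `i = 0, …, m`. -/
def NBeta (𝒱 : Filtration F V m) (l : Fin (m + 1) → ℝ) (x : X) : Submodule ℂ (Sym[ℂ]^2 (V x)) :=
  ⨆ (i : Fin (m + 1)) (j : Fin (m + 1)) (_ : l i + l j ≤ 0),
    symProd ((𝒱.sub i.succ).fiber x) ((𝒱.sub j.succ).fiber x)

/-- The `S²V*`-part of `N(𝒱, λ)` (before the twist by `L`): the sum of the
`V_{i-1}^⊥ ⊗_S V_{j-1}^⊥` over all `i, j` with `λ_i + λ_j ≥ 0`. -/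
def NGamma (𝒱 : Filtration F V m) (l : Fin (m + 1) → ℝ) (x : X) :
    Submodule ℂ (Sym[ℂ]^2 (Dual V x)) :=
  ⨆ (i : Fin (m + 1)) (j : Fin (m + 1)) (_ : 0 ≤ l i + l j),
    symProd (perp ((𝒱.sub i.castSucc).fiber x)) (perp ((𝒱.sub j.castSucc).fiber x))

/-- `d(𝒱, λ, α) = λ_k (deg V_k - α n_k) + ∑_{j=1}^{k-1} (λ_j - λ_{j+1}) (deg V_j - α n_j)`. -/
def weightedDegree (𝒱 : Filtration F V m) (l : Fin (m + 1) → ℝ) (α : ℝ) : ℝ :=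
  l (Fin.last m) *
      (((𝒱.sub (Fin.last (m + 1))).degree : ℝ) - α * ((𝒱.sub (Fin.last (m + 1))).rank : ℝ)) +
    ∑ j : Fin m, (l j.castSucc - l j.succ) *
      (((𝒱.sub j.castSucc.succ).degree : ℝ) - α * ((𝒱.sub j.castSucc.succ).rank : ℝ))

end Filtration

/-- `α`-semistability of the pair `(V, φ)`. -/
def HiggsField.IsSemistable (φ : HiggsField L F V) (α : ℝ) : Prop :=
  ∀ (m : ℕ) (𝒱 : Filtration F V m) (l : Fin (m + 1) → ℝ), Monotone l →
    φ.MemSub (𝒱.NBeta l) (𝒱.NGamma l) → 0 ≤ 𝒱.weightedDegree l α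

end Pairs

end SpHiggs

end

set_option linter.unusedSectionVars false

/-! The weighted degree is linear in `λ`, while `N(𝒱, λ)` depends only on the signs of the sums `λ_i
+ λ_j`. For `t > 0` let `truncSign t` send a weight to `1`, `0` or `-1` by comparison with `±t`.
This map is odd and monotone, so it preserves `λ_i + λ_j ≤ 0` and `λ_i + λ_j ≥ 0`, and truncating
the weights can only enlarge `N`.

If `0 = t₀ < t₁ < ⋯ < t_r`, where `t₁, …, t_r` are the distinct nonzero `|λ_i|`, then `λ = ∑ (t_s -
t_{s-1}) • truncSign t_s λ`. So `d(𝒱, λ, α) ≥ 0` follows from the same inequality for weights in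
`{-1, 0, 1}` (`nonneg_of_truncSign`). Such weights single out two members `V_p ⊆ V_q` of the
filtration, the last of weight at most `-1` and at most `0`. For them `N` lies in the two-step
subbundle (`MemSub.memTwoStep`) and `d` is the two-step difference (`weightedDegree_of_sign`).

Conversely, `V₁ ⊆ V₂` is placed in a strict filtration and semistability is applied to weights `-1,
0, 1` (`IsSemistable.two_step`). The only fact about degrees that enters is that the zero subbundle
has degree `0`. -/

namespace SpHiggs

/-! ### Truncation of real weights -/

section Truncation

/-- The odd step function with jumps at `±t`. -/
noncomputable def truncSign (t x : ℝ) : ℝ := if t ≤ x then 1 else if x ≤ -t then -1 else 0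

lemma truncSign_mono {t : ℝ} (ht : 0 < t) : Monotone (truncSign t) := by
  intro x y h
  unfold truncSign
  split_ifs <;> linarith

lemma truncSign_neg {t : ℝ} (ht : 0 < t) (x : ℝ) : truncSign t (-x) = -truncSign t x := by
  unfold truncSign
  split_ifs <;> linarith [ht]

/-- Monotonicity applied to `x ≤ -y`, then oddness. With its mirror image, this is why truncated
weights still satisfy the conditions defining `N`. -/
lemma truncSign_add_nonpos {t x y : ℝ} (ht : 0 < t) (h : x + y ≤ 0) :
    truncSign t x + truncSign t y ≤ 0 := by
  have := truncSign_mono ht (show x ≤ -y by linarith)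
  rw [truncSign_neg ht] at this
  linarith

lemma truncSign_add_nonneg {t x y : ℝ} (ht : 0 < t) (h : 0 ≤ x + y) :
    0 ≤ truncSign t x + truncSign t y := by
  have := truncSign_mono ht (show -y ≤ x by linarith)
  rw [truncSign_neg ht] at this
  linarith

/-- A linear functional that is nonnegative on all truncations of `l` is nonnegative on `l`. -/
lemma nonneg_of_truncSign {ι : Type*} [Finite ι] (f : (ι → ℝ) →ₗ[ℝ] ℝ) (l : ι → ℝ)
    (hf : ∀ t, 0 < t → 0 ≤ f fun i => truncSign t (l i)) : 0 ≤ f l := by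
  -- Peel off one truncation at a time: each step kills the nonzero entries of least absolute value.
  induction h : (Function.support l).ncard using Nat.strong_induction_on generalizing l with
  | _ k ih =>
  subst h
  by_cases hl : l = 0
  · simp [hl]
  have hne : (Function.support l).Nonempty := Function.support_nonempty_iff.mpr hl
  obtain ⟨i₀, hi₀, hmin⟩ := (Set.toFinite (Function.support l)).exists_minimalFor
    (fun i => |l i|) _ hne
  have hmin' : ∀ i, l i ≠ 0 → |l i₀| ≤ |l i| := fun i hi =>
    (le_total |l i₀| |l i|).elim id fun h => hmin hi h
  have ht : 0 < |l i₀| := abs_pos.mpr hi₀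
  set t := |l i₀| with ht_def
  let l' : ι → ℝ := fun i => l i - t * truncSign t (l i)
  have hcases : ∀ i, l i = 0 ∨ t ≤ l i ∨ l i ≤ -t := fun i => by
    by_cases h0 : l i = 0
    · exact Or.inl h0
    · rcases le_abs'.mp (hmin' i h0) with h | h
      · exact Or.inr (Or.inr h)
      · exact Or.inr (Or.inl h)
  have hlt : (Function.support l').ncard < (Function.support l).ncard := by
    refine Set.ncard_lt_ncard ⟨fun i hi h0 => hi ?_, fun hsub => hsub hi₀ ?_⟩ (Set.toFinite _)
    · simp only [l', truncSign, h0]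
      split_ifs <;> linarith
    · simp only [l', truncSign]
      rcases abs_cases (l i₀) with h | h <;> split_ifs <;> linarith
  have h' : 0 ≤ f l' := by
    refine ih _ hlt l' (fun s hs => ?_) rfl
    -- Nonzero entries of `l` have absolute value at least `t`, and `l'` moves them towards `0` by
    -- exactly `t`. So truncating `l'` at `s` is truncating `l` at `s + t`, and the hypothesis
    -- passes to `l'`.
    have : (fun i => truncSign s (l' i)) = fun i => truncSign (s + t) (l i) := by
      funext i
      simp only [l', truncSign]
      rcases hcases i with h | h | h <;> split_ifs <;> linarith
    rw [this]
    exact hf _ (by linarith)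
  have hdec : l = l' + t • fun i => truncSign t (l i) := by
    funext i
    simp [l']
  rw [hdec, map_add, map_smul, smul_eq_mul]
  have := mul_nonneg ht.le (hf t ht)
  linarith

end Truncation

/-! ### Sums over chains -/

section Chains

/-- Lower sets of `Fin n` are initial segments. -/
lemma exists_forall_iff_castSucc_lt {n : ℕ} (P : Fin n → Prop)
    (hP : ∀ i j, i ≤ j → P j → P i) : ∃ p : Fin (n + 1), ∀ i, P i ↔ i.castSucc < p := by
  classical
  by_cases h : ∃ i, ¬ P i
  · obtain ⟨i₀, hi₀, hmin⟩ := (Set.toFinite {i | ¬ P i}).exists_minimal h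
    refine ⟨i₀.castSucc, fun i => ⟨fun hi => ?_, fun hi => ?_⟩⟩
    · rw [Fin.castSucc_lt_castSucc_iff]
      by_contra hle
      exact hi₀ (hP _ _ (not_lt.mp hle) hi)
    · rw [Fin.castSucc_lt_castSucc_iff] at hi
      by_contra hn
      exact absurd (hmin hn hi.le) (not_le.mpr hi)
  · push Not at h
    exact ⟨Fin.last n, fun i => ⟨fun _ => Fin.castSucc_lt_last i, fun _ => h i⟩⟩

lemma sum_initial_differences {n : ℕ} (a : Fin (n + 1) → ℝ) (p : Fin (n + 1)) :
    ∑ i : Fin n, (if i.castSucc < p then a i.succ - a i.castSucc else 0) = a p - a 0 := by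
  induction p using Fin.induction with
  | zero => simp
  | succ j ih =>
    have : ∀ i : Fin n, (if i.castSucc < j.succ then a i.succ - a i.castSucc else 0) =
        (if i.castSucc < j.castSucc then a i.succ - a i.castSucc else 0) +
          (if i = j then a i.succ - a i.castSucc else 0) := by
      intro i
      rcases lt_trichotomy i j with h | h | h
      · rw [if_pos (Fin.castSucc_lt_succ_iff.mpr h.le),
          if_pos (Fin.castSucc_lt_castSucc_iff.mpr h), if_neg h.ne, add_zero]
      · subst h
        simp
      · rw [if_neg (by rw [Fin.castSucc_lt_succ_iff]; exact not_le.mpr h),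
          if_neg (by rw [Fin.castSucc_lt_castSucc_iff]; exact h.asymm), if_neg h.ne', add_zero]
    simp_rw [this, Finset.sum_add_distrib, ih]
    simp

/-- Summation by parts. -/
lemma sum_by_parts {m : ℕ} (l : Fin (m + 1) → ℝ) (a : Fin (m + 2) → ℝ) :
    l (Fin.last m) * a (Fin.last (m + 1)) +
        ∑ j : Fin m, (l j.castSucc - l j.succ) * a j.castSucc.succ =
      l 0 * a 0 + ∑ i, l i * (a i.succ - a i.castSucc) := by
  simp_rw [mul_sub, sub_mul, Finset.sum_sub_distrib]
  rw [Fin.sum_univ_castSucc (fun i => l i * a i.succ),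
    Fin.sum_univ_succ (fun i => l i * a i.castSucc)]
  simp only [Fin.succ_last, Fin.succ_castSucc, Fin.castSucc_zero]
  ring

end Chains

/-! ### Monotonicity of the fibrewise constructions -/

section Fibre

variable {M : Type*} [AddCommGroup M] [Module ℂ M]

lemma symProd_mono {A A' B B' : Submodule ℂ M} (hA : A ≤ A') (hB : B ≤ B') :
    symProd A B ≤ symProd A' B' :=
  Submodule.span_mono (Set.image2_subset hA hB)

lemma symMul_comm (a b : M) : symMul a b = symMul b a := by
  have h := SymmetricPower.tprod_equiv (R := ℂ) (Equiv.swap (0 : Fin 2) 1) ![a, b]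
  unfold symMul
  rw [← h]
  congr 1
  funext i
  fin_cases i <;> simp

lemma symProd_comm (A B : Submodule ℂ M) : symProd A B = symProd B A := by
  unfold symProd
  rw [Set.image2_swap]
  simp_rw [symMul_comm]

lemma symProd_bot_left (B : Submodule ℂ M) : symProd ⊥ B = ⊥ := by
  refine le_bot_iff.mp (Submodule.span_le.mpr ?_)
  rintro _ ⟨a, ha, b, -, rfl⟩
  exact (SymmetricPower.tprod ℂ).map_coord_zero (m := ![a, b]) 0 ((Submodule.mem_bot ℂ).mp ha)

lemma twist_mono {l A : Type*} [AddCommMonoid l] [Module ℂ l] [AddCommMonoid A] [Module ℂ A]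
    {N N' : Submodule ℂ A} (h : N ≤ N') : twist l N ≤ twist l N' := by
  have : N.subtype.lTensor l =
      N'.subtype.lTensor l ∘ₗ (Submodule.inclusion h).lTensor l := by
    rw [← LinearMap.lTensor_comp, Submodule.subtype_comp_inclusion]
  unfold twist
  rw [this]
  exact LinearMap.range_comp_le_range _ _

end Fibre

/-! ### Annihilators, and rank and degree of subbundles -/

section Subbundles

variable {X : Type*} [TopologicalSpace X] [ChartedSpace ℂ X]
  {F : Type*} [NormedAddCommGroup F] [NormedSpace ℂ F] {V : X → Type*}
  [TopologicalSpace (TotalSpace F V)] [∀ x, TopologicalSpace (V x)] [FiberBundle F V]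
  [∀ x, AddCommGroup (V x)] [∀ x, Module ℂ (V x)]

lemma perp_anti {x : X} {W W' : Submodule ℂ (V x)} (h : W ≤ W') : perp W' ≤ perp W :=
  fun _ hf y hy => hf y (h hy)

lemma perp_bot {x : X} : perp (⊥ : Submodule ℂ (V x)) = ⊤ :=
  top_le_iff.mp fun f _ y hy => by rw [(Submodule.mem_bot ℂ).mp hy, map_zero]

lemma perp_top {x : X} : perp (⊤ : Submodule ℂ (V x)) = ⊥ :=
  le_bot_iff.mp fun f hf => by
    rw [Submodule.mem_bot]
    ext y
    exact hf y trivial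

namespace HolSubbundle

lemma finrank_fiber (W : HolSubbundle F V) (x : X) : Module.finrank ℂ (W.fiber x) = W.rank := by
  obtain ⟨U, -, hx, e, he⟩ := W.exists_frame x
  rw [← he.span_eq x hx, finrank_span_eq_card (he.linearIndependent x hx), Fintype.card_fin]

/-- The order compares fibres only, and `rank` is separate data. A point of `X` is needed to recover
it as a fibre dimension. -/
lemma le_antisymm' [Nonempty X] {W W' : HolSubbundle F V} (h : W ≤ W') (h' : W' ≤ W) :
    W = W' := by
  have hf : W.fiber = W'.fiber := le_antisymm (show W.fiber ≤ W'.fiber from h) h'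
  obtain ⟨x⟩ := ‹Nonempty X›
  have hr : W.rank = W'.rank := by rw [← W.finrank_fiber x, ← W'.finrank_fiber x, hf]
  cases W
  cases W'
  cases hf
  cases hr
  rfl

lemma lt_of_le_of_ne' [Nonempty X] {W W' : HolSubbundle F V} (h : W ≤ W') (hne : W ≠ W') :
    W < W' :=
  lt_of_le_not_ge h fun h' => hne (le_antisymm' h h')

lemma bot_le' (W : HolSubbundle F V) : (⊥ : HolSubbundle F V) ≤ W :=
  fun _ => bot_le

lemma le_top' [FiniteDimensional ℂ F] [VectorBundle ℂ F V] [ContMDiffVectorBundle ω F V 𝓘(ℂ)]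
    (W : HolSubbundle F V) : W ≤ (⊤ : HolSubbundle F V) :=
  fun _ => le_top

lemma rank_bot : (⊥ : HolSubbundle F V).rank = 0 := rfl

lemma rank_top [FiniteDimensional ℂ F] [VectorBundle ℂ F V] [ContMDiffVectorBundle ω F V 𝓘(ℂ)] :
    (⊤ : HolSubbundle F V).rank = Module.finrank ℂ F := rfl

/-- The empty determinant is the constant `1`, of order `0` everywhere, so the divisor vanishes. -/
lemma HasDegree.eq_zero_of_bot {d : ℤ} (h : (⊥ : HolSubbundle F V).HasDegree d) : d = 0 := by
  obtain ⟨s, D, hD, rfl⟩ := h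
  have : IsEmpty (Fin (⊥ : HolSubbundle F V).rank) := inferInstanceAs (IsEmpty (Fin 0))
  refine Finset.sum_eq_zero fun x _ => ?_
  obtain ⟨U, e, A, -, -, -, -, -, hA⟩ := hD x
  simp only [Matrix.det_isEmpty] at hA
  rw [meromorphicOrderAt_const] at hA
  simpa [eq_comm] using hA

lemma degree_bot : (⊥ : HolSubbundle F V).degree = 0 := by
  unfold degree
  split_ifs with h
  · exact h.choose_spec.eq_zero_of_bot
  · rfl

end HolSubbundle

end Subbundles

/-! ### Filtrations, weights and semistability -/

section Pairs

variable {X : Type*} [TopologicalSpace X] [ChartedSpace ℂ X]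
  {L : X → Type*} [TopologicalSpace (TotalSpace ℂ L)] [∀ x, TopologicalSpace (L x)]
  [FiberBundle ℂ L] [∀ x, AddCommGroup (L x)] [∀ x, Module ℂ (L x)]
  {F : Type*} [NormedAddCommGroup F] [NormedSpace ℂ F] {V : X → Type*}
  [TopologicalSpace (TotalSpace F V)] [∀ x, TopologicalSpace (V x)] [FiberBundle F V]
  [∀ x, AddCommGroup (V x)] [∀ x, Module ℂ (V x)] [VectorBundle ℂ F V]

lemma HiggsField.MemSub.mono {φ : HiggsField L F V} {B B' : ∀ x, Submodule ℂ (Sym[ℂ]^2 (V x))}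
    {C C' : ∀ x, Submodule ℂ (Sym[ℂ]^2 (Dual V x))} (h : φ.MemSub B C)
    (hB : ∀ x, B x ≤ B' x) (hC : ∀ x, C x ≤ C' x) : φ.MemSub B' C' :=
  fun x => ⟨twist_mono (hB x) (h x).1, twist_mono (hC x) (h x).2⟩

variable [FiniteDimensional ℂ F] [ContMDiffVectorBundle ω F V 𝓘(ℂ)]

namespace Filtration

variable {m : ℕ}

lemma symProd_le_NBeta (𝒱 : Filtration F V m) {l : Fin (m + 1) → ℝ} {i j : Fin (m + 1)}
    (h : l i + l j ≤ 0) (x : X) :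
    symProd ((𝒱.sub i.succ).fiber x) ((𝒱.sub j.succ).fiber x) ≤ 𝒱.NBeta l x :=
  le_iSup_of_le i (le_iSup_of_le j (le_iSup_of_le h le_rfl))

lemma symProd_le_NGamma (𝒱 : Filtration F V m) {l : Fin (m + 1) → ℝ} {i j : Fin (m + 1)}
    (h : 0 ≤ l i + l j) (x : X) :
    symProd (perp ((𝒱.sub i.castSucc).fiber x)) (perp ((𝒱.sub j.castSucc).fiber x)) ≤
      𝒱.NGamma l x :=
  le_iSup_of_le i (le_iSup_of_le j (le_iSup_of_le h le_rfl))

lemma NBeta_le (𝒱 : Filtration F V m) {l : Fin (m + 1) → ℝ} {x : X}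
    {N : Submodule ℂ (Sym[ℂ]^2 (V x))}
    (h : ∀ i j, l i + l j ≤ 0 →
      symProd ((𝒱.sub i.succ).fiber x) ((𝒱.sub j.succ).fiber x) ≤ N) : 𝒱.NBeta l x ≤ N :=
  iSup_le fun i => iSup_le fun j => iSup_le fun hij => h i j hij

lemma NGamma_le (𝒱 : Filtration F V m) {l : Fin (m + 1) → ℝ} {x : X}
    {N : Submodule ℂ (Sym[ℂ]^2 (Dual V x))}
    (h : ∀ i j, 0 ≤ l i + l j →
      symProd (perp ((𝒱.sub i.castSucc).fiber x)) (perp ((𝒱.sub j.castSucc).fiber x)) ≤ N) :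
    𝒱.NGamma l x ≤ N :=
  iSup_le fun i => iSup_le fun j => iSup_le fun hij => h i j hij

/-- The number `deg V_i - α n_i`. -/
noncomputable def slopeDefect (𝒱 : Filtration F V m) (α : ℝ) (i : Fin (m + 2)) : ℝ :=
  ((𝒱.sub i).degree : ℝ) - α * ((𝒱.sub i).rank : ℝ)

lemma slopeDefect_zero (𝒱 : Filtration F V m) (α : ℝ) : 𝒱.slopeDefect α 0 = 0 := by
  simp [slopeDefect, 𝒱.sub_zero, HolSubbundle.degree_bot, HolSubbundle.rank_bot]

lemma slopeDefect_last (𝒱 : Filtration F V m) (α : ℝ) :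
    𝒱.slopeDefect α (Fin.last (m + 1)) =
      ((⊤ : HolSubbundle F V).degree : ℝ) - α * (Module.finrank ℂ F : ℝ) := by
  rw [slopeDefect, 𝒱.sub_last, HolSubbundle.rank_top]

/-- Summation by parts, whose boundary term vanishes because `V₀ = 0`. Linearity in the weights is
now visible. -/
lemma weightedDegree_eq_sum (𝒱 : Filtration F V m) (l : Fin (m + 1) → ℝ) (α : ℝ) :
    𝒱.weightedDegree l α =
      ∑ i, l i * (𝒱.slopeDefect α i.succ - 𝒱.slopeDefect α i.castSucc) := by
  have h := sum_by_parts l (𝒱.slopeDefect α)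
  rw [slopeDefect_zero, mul_zero, zero_add] at h
  exact h

/-- The weighted degree as a linear functional of the weights. -/
noncomputable def weightedDegreeHom (𝒱 : Filtration F V m) (α : ℝ) : (Fin (m + 1) → ℝ) →ₗ[ℝ] ℝ where
  toFun l := 𝒱.weightedDegree l α
  map_add' l l' := by
    simp only [weightedDegree_eq_sum, Pi.add_apply, add_mul, Finset.sum_add_distrib]
  map_smul' c l := by
    simp only [weightedDegree_eq_sum, Pi.smul_apply, smul_eq_mul, mul_assoc, Finset.mul_sum,
      RingHom.id_apply]

/-- The weighted degree for the weights `-1` (up to `p`), `0` (up to `q`) and `1`. -/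
lemma weightedDegree_of_sign (𝒱 : Filtration F V m) (α : ℝ) {l : Fin (m + 1) → ℝ}
    {p q : Fin (m + 2)}
    (hl : ∀ i, l i = 1 - (if i.castSucc < q then 1 else 0) - (if i.castSucc < p then 1 else 0)) :
    𝒱.weightedDegree l α = 𝒱.slopeDefect α (Fin.last (m + 1)) - 𝒱.slopeDefect α q -
      𝒱.slopeDefect α p := by
  -- Each of the three terms of the weight is the indicator of an initial segment, the constant `1`
  -- being that of all indices, so each sum telescopes.
  have hlast := sum_initial_differences (𝒱.slopeDefect α) (Fin.last (m + 1))
  have hp := sum_initial_differences (𝒱.slopeDefect α) p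
  have hq := sum_initial_differences (𝒱.slopeDefect α) q
  simp only [slopeDefect_zero, _root_.sub_zero] at hlast hp hq
  rw [weightedDegree_eq_sum, ← hlast, ← hp, ← hq, ← Finset.sum_sub_distrib,
    ← Finset.sum_sub_distrib]
  refine Finset.sum_congr rfl fun i _ => ?_
  rw [hl, if_pos (Fin.castSucc_lt_last i)]
  split_ifs <;> ring

end Filtration

/-- The filtration `0 ⊊ V`. -/
noncomputable def Filtration.one (h : (⊥ : HolSubbundle F V) < ⊤) : Filtration F V 0 where
  sub := ![⊥, ⊤]
  strictMono := by
    rw [Fin.strictMono_iff_lt_succ]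
    intro i
    fin_cases i
    exact h
  sub_zero := rfl
  sub_last := rfl

/-- The filtration `0 ⊊ W ⊊ V`. -/
noncomputable def Filtration.two (W : HolSubbundle F V) (h₀ : ⊥ < W) (h₁ : W < ⊤) : Filtration F V 1 where
  sub := ![⊥, W, ⊤]
  strictMono := by
    rw [Fin.strictMono_iff_lt_succ]
    intro i
    fin_cases i
    exacts [h₀, h₁]
  sub_zero := rfl
  sub_last := rfl

/-- The filtration `0 ⊊ W ⊊ W' ⊊ V`. -/
noncomputable def Filtration.three (W W' : HolSubbundle F V) (h₀ : ⊥ < W) (h : W < W') (h₁ : W' < ⊤) :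
    Filtration F V 2 where
  sub := ![⊥, W, W', ⊤]
  strictMono := by
    rw [Fin.strictMono_iff_lt_succ]
    intro i
    fin_cases i
    exacts [h₀, h, h₁]
  sub_zero := rfl
  sub_last := rfl

/-- `φ` is a section of the subbundle defined by the two-step filtration `V₁ ⊆ V₂ ⊆ V`. -/
abbrev HiggsField.MemTwoStep (φ : HiggsField L F V) (V₁ V₂ : HolSubbundle F V) : Prop :=
  φ.MemSub (fun x => symSq (V₂.fiber x) ⊔ symProd (V₁.fiber x) ⊤)
    (fun x => symSq (perp (V₁.fiber x)) ⊔ symProd (perp (V₂.fiber x)) ⊤)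

/-- Semistability applied to the weights `-1`, `0`, `1` on a filtration that contains
`V₁ ⊆ V₂`. -/
lemma HiggsField.IsSemistable.two_step {φ : HiggsField L F V} {α : ℝ} (hφ : φ.IsSemistable α)
    {m : ℕ} (𝒱 : Filtration F V m) {p q : Fin (m + 2)} (hpq : p ≤ q)
    (h : φ.MemTwoStep (𝒱.sub p) (𝒱.sub q)) :
    ((⊤ : HolSubbundle F V).degree : ℝ) - ((𝒱.sub q).degree : ℝ) - ((𝒱.sub p).degree : ℝ) ≥
      α * ((Module.finrank ℂ F : ℝ) - ((𝒱.sub q).rank : ℝ) - ((𝒱.sub p).rank : ℝ)) := by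
  -- The weight `l i` belongs to `V_{i+1}`, so `i.castSucc < q` says that `V_{i+1}` is contained in
  -- `V_q`.
  let l : Fin (m + 1) → ℝ := fun i =>
    1 - (if i.castSucc < q then 1 else 0) - (if i.castSucc < p then 1 else 0)
  have hl : Monotone l := by
    intro i j hij
    have hij' : i.castSucc ≤ j.castSucc := hij
    have h1 : j.castSucc < q → i.castSucc < q := hij'.trans_lt
    have h2 : j.castSucc < p → i.castSucc < p := hij'.trans_lt
    simp only [l]
    split_ifs <;> first | (exfalso; tauto) | norm_num
  have hbot : (𝒱.sub 0).fiber = fun _ => ⊥ := by rw [𝒱.sub_zero]; rfl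
  have htop : (𝒱.sub (Fin.last (m + 1))).fiber = fun _ => ⊤ := by rw [𝒱.sub_last]; rfl
  have hle : ∀ i, l i ≤ 1 := fun i => by
    simp only [l]
    split_ifs <;> norm_num
  have hge : ∀ i, -1 ≤ l i := fun i => by
    simp only [l]
    split_ifs <;> norm_num
  have hlq : ∀ i, i.castSucc < q → l i ≤ 0 := fun i hi => by
    simp only [l, if_pos hi]
    split_ifs <;> norm_num
  have hlp : ∀ i, i.castSucc < p → l i = -1 := fun i hi => by
    simp only [l, if_pos hi, if_pos (hi.trans_le hpq)]
    norm_num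
  have hlp' : ∀ i, p ≤ i.castSucc → 0 ≤ l i := fun i hi => by
    simp only [l, if_neg hi.not_gt]
    split_ifs <;> norm_num
  have hlq' : ∀ i, q ≤ i.castSucc → l i = 1 := fun i hi => by
    simp only [l, if_neg hi.not_gt, if_neg (hpq.trans hi).not_gt]
    norm_num
  have hβ : ∀ x, symSq ((𝒱.sub q).fiber x) ⊔ symProd ((𝒱.sub p).fiber x) ⊤ ≤ 𝒱.NBeta l x := by
    refine fun x => sup_le ?_ ?_
    · rcases Fin.eq_zero_or_eq_succ q with rfl | ⟨i, rfl⟩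
      · simp [symSq, hbot, symProd_bot_left]
      · have := hlq i Fin.castSucc_lt_succ
        exact 𝒱.symProd_le_NBeta (by linarith) x
    · rcases Fin.eq_zero_or_eq_succ p with rfl | ⟨i, rfl⟩
      · simp [hbot, symProd_bot_left]
      · have h1 := hlp i Fin.castSucc_lt_succ
        -- The factor `V` is the last member, of weight at most `1`, which the weight `-1` of `V_p`
        -- compensates.
        have h2 := hle (Fin.last m)
        have := 𝒱.symProd_le_NBeta (l := l) (i := i) (j := Fin.last m) (by linarith) x
        rwa [Fin.succ_last, htop] at this
  have hγ : ∀ x, symSq (perp ((𝒱.sub p).fiber x)) ⊔ symProd (perp ((𝒱.sub q).fiber x)) ⊤ ≤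
      𝒱.NGamma l x := by
    refine fun x => sup_le ?_ ?_
    · rcases Fin.eq_castSucc_or_eq_last p with ⟨i, rfl⟩ | rfl
      · have := hlp' i le_rfl
        exact 𝒱.symProd_le_NGamma (by linarith) x
      · simp [symSq, htop, perp_top, symProd_bot_left]
    · rcases Fin.eq_castSucc_or_eq_last q with ⟨i, rfl⟩ | rfl
      · have h1 := hlq' i le_rfl
        -- Dually, `V*` is the annihilator of `V₀`, paired with the first weight, which is at least
        -- `-1`.
        have h2 := hge 0
        have := 𝒱.symProd_le_NGamma (l := l) (i := i) (j := 0) (by linarith) x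
        rwa [Fin.castSucc_zero, hbot, perp_bot] at this
      · simp [htop, perp_top, symProd_bot_left]
  have hd := hφ m 𝒱 l hl (h.mono hβ hγ)
  rw [𝒱.weightedDegree_of_sign α (p := p) (q := q) fun i => rfl,
    Filtration.slopeDefect_last] at hd
  simp only [Filtration.slopeDefect] at hd
  linarith

/-- Two nested subbundles are members of a strict filtration, unless `V = 0`. -/
lemma Filtration.exists_sub_eq [Nonempty X] {V₁ V₂ : HolSubbundle F V} (h : V₁ ≤ V₂)
    (hV : (⊥ : HolSubbundle F V) ≠ ⊤) :
    ∃ (m : ℕ) (𝒱 : Filtration F V m) (p q : Fin (m + 2)),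
      p ≤ q ∧ 𝒱.sub p = V₁ ∧ 𝒱.sub q = V₂ := by
  have hlt {W W' : HolSubbundle F V} (h : W ≤ W') (hne : W ≠ W') : W < W' :=
    HolSubbundle.lt_of_le_of_ne' h hne
  by_cases h₁ : V₁ = ⊥
  · subst h₁
    by_cases h₂ : V₂ = ⊥
    · exact ⟨0, .one (hlt (HolSubbundle.bot_le' _) hV), 0, 0, le_rfl, rfl, h₂.symm⟩
    by_cases h₃ : V₂ = ⊤
    · exact ⟨0, .one (hlt (HolSubbundle.bot_le' _) hV), 0, 1, Fin.zero_le _, rfl, h₃.symm⟩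
    exact ⟨1, .two V₂ (hlt h (Ne.symm h₂)) (hlt V₂.le_top' h₃), 0, 1, Fin.zero_le _, rfl, rfl⟩
  by_cases h₂ : V₂ = ⊤
  · subst h₂
    by_cases h₃ : V₁ = ⊤
    · exact ⟨0, .one (hlt (HolSubbundle.bot_le' _) hV), 1, 1, le_rfl, h₃.symm, rfl⟩
    exact ⟨1, .two V₁ (hlt V₁.bot_le' (Ne.symm h₁)) (hlt h h₃), 1, 2, by decide, rfl, rfl⟩
  by_cases h₃ : V₁ = V₂
  · subst h₃
    exact ⟨1, .two V₁ (hlt V₁.bot_le' (Ne.symm h₁)) (hlt V₁.le_top' h₂), 1, 1, le_rfl, rfl, rfl⟩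
  exact ⟨2, .three V₁ V₂ (hlt V₁.bot_le' (Ne.symm h₁)) (hlt h h₃) (hlt V₂.le_top' h₂), 1, 2,
    by decide, rfl, rfl⟩

lemma HiggsField.IsSemistable.le_of_memTwoStep [Nonempty X] {φ : HiggsField L F V} {α : ℝ}
    (hφ : φ.IsSemistable α) {V₁ V₂ : HolSubbundle F V} (h : V₁ ≤ V₂)
    (hmem : φ.MemTwoStep V₁ V₂) :
    ((⊤ : HolSubbundle F V).degree : ℝ) - (V₂.degree : ℝ) - (V₁.degree : ℝ) ≥
      α * ((Module.finrank ℂ F : ℝ) - (V₂.rank : ℝ) - (V₁.rank : ℝ)) := by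
  -- The zero bundle has no strict filtration, so semistability says nothing there; both sides are
  -- then `0`.
  by_cases hV : (⊥ : HolSubbundle F V) = ⊤
  · have hbot : ∀ W : HolSubbundle F V, W = ⊥ := fun W =>
      HolSubbundle.le_antisymm' (hV ▸ W.le_top') W.bot_le'
    rw [← HolSubbundle.rank_top (V := V), hbot ⊤, hbot V₁, hbot V₂, HolSubbundle.degree_bot,
      HolSubbundle.rank_bot]
    simp
  · obtain ⟨m, 𝒱, p, q, hpq, rfl, rfl⟩ := Filtration.exists_sub_eq h hV
    exact hφ.two_step 𝒱 hpq hmem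

/-- For weights `-1`, `0`, `1`, the subbundle `N(𝒱, λ)` lies in the one defined by two steps of
the filtration. -/
lemma HiggsField.MemSub.memTwoStep {φ : HiggsField L F V} {m : ℕ} {𝒱 : Filtration F V m}
    {l : Fin (m + 1) → ℝ} {p q : Fin (m + 2)} (hpq : p ≤ q)
    (hl : ∀ i, l i = 1 - (if i.castSucc < q then 1 else 0) - (if i.castSucc < p then 1 else 0))
    (h : φ.MemSub (𝒱.NBeta l) (𝒱.NGamma l)) : φ.MemTwoStep (𝒱.sub p) (𝒱.sub q) := by
  have hmono : ∀ {a b : Fin (m + 2)} (x : X), a ≤ b →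
      (𝒱.sub a).fiber x ≤ (𝒱.sub b).fiber x := fun x hab => 𝒱.strictMono.monotone hab x
  have hcases : ∀ i : Fin (m + 1), (i.castSucc < p ∧ l i = -1) ∨
      (p ≤ i.castSucc ∧ i.castSucc < q ∧ l i = 0) ∨ (q ≤ i.castSucc ∧ l i = 1) := fun i => by
    rw [hl]
    rcases lt_or_ge i.castSucc p with hp | hp
    · simp [hp, hp.trans_le hpq]
    · rcases lt_or_ge i.castSucc q with hq | hq
      · simp [hp, hp.not_gt, hq]
      · simp [hp.not_gt, hq, hq.not_gt]
  have hsucc : ∀ {i : Fin (m + 1)} {a : Fin (m + 2)}, i.castSucc < a → i.succ ≤ a :=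
    fun h => Fin.castSucc_lt_iff_succ_le.mp h
  refine h.mono (fun x => 𝒱.NBeta_le fun i j hij => ?_) (fun x => 𝒱.NGamma_le fun i j hij => ?_)
  -- Two weights in `{-1, 0, 1}` with sum at most `0` either include a `-1`, giving a factor inside
  -- `V_p`, or are both `0`, giving two factors inside `V_q`.
  · have hleft : ∀ i j : Fin (m + 1), i.castSucc < p →
        symProd ((𝒱.sub i.succ).fiber x) ((𝒱.sub j.succ).fiber x) ≤
          symSq ((𝒱.sub q).fiber x) ⊔ symProd ((𝒱.sub p).fiber x) ⊤ := fun i j hi =>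
      le_sup_of_le_right (symProd_mono (hmono x (hsucc hi)) le_top)
    rcases hcases i with ⟨hi, -⟩ | ⟨-, hi, hi'⟩ | ⟨-, hi'⟩
    · exact hleft i j hi
    all_goals rcases hcases j with ⟨hj, -⟩ | ⟨-, hj, hj'⟩ | ⟨-, hj'⟩
    any_goals linarith
    · exact (symProd_comm _ _).trans_le (hleft j i hj)
    · exact le_sup_of_le_left (symProd_mono (hmono x (hsucc hi)) (hmono x (hsucc hj)))
    · exact (symProd_comm _ _).trans_le (hleft j i hj)
  -- Dually, either some weight is `1`, giving a factor inside `V_q^⊥`, or both are `0`, giving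
  -- factors inside `V_p^⊥`.
  · have hleft : ∀ i j : Fin (m + 1), q ≤ i.castSucc →
        symProd (perp ((𝒱.sub i.castSucc).fiber x)) (perp ((𝒱.sub j.castSucc).fiber x)) ≤
          symSq (perp ((𝒱.sub p).fiber x)) ⊔ symProd (perp ((𝒱.sub q).fiber x)) ⊤ :=
      fun i j hi => le_sup_of_le_right (symProd_mono (perp_anti (hmono x hi)) le_top)
    rcases hcases i with ⟨-, hi'⟩ | ⟨hi, -, hi'⟩ | ⟨hi, -⟩
    rotate_left 2
    · exact hleft i j hi
    all_goals rcases hcases j with ⟨-, hj'⟩ | ⟨hj, -, hj'⟩ | ⟨hj, -⟩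
    any_goals linarith
    · exact (symProd_comm _ _).trans_le (hleft j i hj)
    · exact le_sup_of_le_left
        (symProd_mono (perp_anti (hmono x hi)) (perp_anti (hmono x hj)))
    · exact (symProd_comm _ _).trans_le (hleft j i hj)

lemma HiggsField.isSemistable_of_twoStep {φ : HiggsField L F V} {α : ℝ}
    (H : ∀ V₁ V₂ : HolSubbundle F V, V₁ ≤ V₂ → φ.MemTwoStep V₁ V₂ →
      ((⊤ : HolSubbundle F V).degree : ℝ) - (V₂.degree : ℝ) - (V₁.degree : ℝ) ≥
        α * ((Module.finrank ℂ F : ℝ) - (V₂.rank : ℝ) - (V₁.rank : ℝ))) :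
    φ.IsSemistable α := by
  intro m 𝒱 l hl hmem
  refine nonneg_of_truncSign (𝒱.weightedDegreeHom α) l fun t ht => ?_
  -- The cut `p` is closed at `-t` and `q` is open at `t`, matching the values of `truncSign` at its
  -- jumps.
  obtain ⟨p, hp⟩ := exists_forall_iff_castSucc_lt (fun i => l i ≤ -t)
    fun i j hij hj => (hl hij).trans hj
  obtain ⟨q, hq⟩ := exists_forall_iff_castSucc_lt (fun i => l i < t)
    fun i j hij hj => (hl hij).trans_lt hj
  have hpq : p ≤ q := by
    by_contra hlt
    rw [not_le] at hlt
    obtain ⟨i, rfl⟩ := Fin.exists_castSucc_eq.mpr (hlt.trans_le (Fin.le_last p)).ne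
    have h1 := (hp i).mpr hlt
    have h2 := mt (hq i).mp (lt_irrefl _)
    linarith
  have hsign : ∀ i, truncSign t (l i) =
      1 - (if i.castSucc < q then 1 else 0) - (if i.castSucc < p then 1 else 0) := fun i => by
    simp only [← hp, ← hq, truncSign]
    split_ifs <;> linarith
  have hmem' : φ.MemSub (𝒱.NBeta fun i => truncSign t (l i))
      (𝒱.NGamma fun i => truncSign t (l i)) :=
    hmem.mono
      (fun x => 𝒱.NBeta_le fun i j hij => 𝒱.symProd_le_NBeta (truncSign_add_nonpos ht hij) x)
      (fun x => 𝒱.NGamma_le fun i j hij => 𝒱.symProd_le_NGamma (truncSign_add_nonneg ht hij) x)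
  have h := H _ _ (𝒱.strictMono.monotone hpq) (hmem'.memTwoStep hpq hsign)
  change 0 ≤ 𝒱.weightedDegree (fun i => truncSign t (l i)) α
  rw [𝒱.weightedDegree_of_sign α hsign, Filtration.slopeDefect_last]
  simp only [Filtration.slopeDefect]
  linarith

end Pairs

end SpHiggs

theorem mainTheorem7
    -- a closed Riemann surface
    {X : Type*} [TopologicalSpace X] [T2Space X] [CompactSpace X] [ConnectedSpace X]
    [ChartedSpace ℂ X] [IsManifold 𝓘(ℂ) ω X]
    -- a holomorphic line bundle
    {L : X → Type*} [∀ x, AddCommGroup (L x)] [∀ x, Module ℂ (L x)]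
    [TopologicalSpace (TotalSpace ℂ L)] [∀ x, TopologicalSpace (L x)]
    [FiberBundle ℂ L] [VectorBundle ℂ ℂ L] [ContMDiffVectorBundle ω ℂ L 𝓘(ℂ)]
    -- a holomorphic vector bundle
    {F : Type*} [NormedAddCommGroup F] [NormedSpace ℂ F] [FiniteDimensional ℂ F]
    {V : X → Type*} [∀ x, AddCommGroup (V x)] [∀ x, Module ℂ (V x)]
    [TopologicalSpace (TotalSpace F V)] [∀ x, TopologicalSpace (V x)]
    [FiberBundle F V] [VectorBundle ℂ F V] [ContMDiffVectorBundle ω F V 𝓘(ℂ)]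
    (φ : SpHiggs.HiggsField L F V) (α : ℝ) :
    φ.IsSemistable α ↔
      ∀ V₁ V₂ : SpHiggs.HolSubbundle F V, V₁ ≤ V₂ →
        φ.MemSub
          (fun x => SpHiggs.symSq (V₂.fiber x) ⊔ SpHiggs.symProd (V₁.fiber x) ⊤)
          (fun x => SpHiggs.symSq (SpHiggs.perp (V₁.fiber x)) ⊔
            SpHiggs.symProd (SpHiggs.perp (V₂.fiber x)) ⊤) →
        ((⊤ : SpHiggs.HolSubbundle F V).degree : ℝ) - (V₂.degree : ℝ) - (V₁.degree : ℝ) ≥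
          α * ((Module.finrank ℂ F : ℝ) - (V₂.rank : ℝ) - (V₁.rank : ℝ)) :=
  ⟨fun h _ _ hle hmem => h.le_of_memTwoStep hle hmem,
    fun H => SpHiggs.HiggsField.isSemistable_of_twoStep H⟩
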